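/- Consider quarter plane walks with steps W$=(-1,0)$, S$=(0,-1)$ and NE$=(1,1)$: walks that start at $(0,0)$, take steps from this set, and stay in $\{(i,j): i,j\ge 0\}$. Let $q(i,j;n)$ be the number of such walks of length $n$ ending at $(i,j)$, and set $$Q(x,y;t)=\sum_{i,j,n\ge 0} q(i,j;n)\,x^iy^jt^n,\qquad Q_d(x;t)=\sum_{i,n\ge 0} q(i,i;n)\,x^it^n .$$ There is a unique power series $W\equiv W(t)\in\mathbb{Q}[[t]]$ such that $W=t(2+W^3)$. Below, square roots denote the power series in $t$ with coefficients in $\mathbb{Q}[x]$ and constant term $1$ (in $t$), and the identities involving $x$ hold in the field $\mathbb{Q}(x)((t))$. (1) The generating function of walks ending on the $x$-axis is $$Q(x,0;t)=\frac1{tx}\left(\frac1{2t}-\frac1x-\left(\frac1W-\frac1x\right)\sqrt{1-xW^2}\right).$$ (2) For all $i\ge 0$, the length generating function of walks ending at $(i,0)$ is $$[x^i]Q(x,0;t)=\frac{W^{2i+1}}{2\cdot 4^i\,t}\left(C_i-\frac{C_{i+1}W^3}{4}\right),$$ where $C_i=\frac1{i+1}\binom{2i}{i}$ is the $i$-th Catalan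 number. (3) For all $i,m\ge 0$, the number of such walks of length $3m+2i$ is $$q(i,0;3m+2i)=\frac{4^m(2i+1)}{(m+i+1)(2m+2i+1)}\binom{2i}{i}\binom{3m+2i}{m}.$$ (4) The generating function of walks ending on the diagonal is $$Q_d(x;t)=\frac{W-1/x}{t\sqrt{1-xW(1+W^3/4)+x^2W^2/4}}+\frac1{xt}.$$ -/

import Mathlib

noncomputable section

namespace QuarterPlane

/-- The position reached after the first `k` steps of the walk that starts at the origin
and has step sequence `s`. -/
def position {n : ℕ} (s : Fin n → ℤ × ℤ) (k : ℕ) : ℤ × ℤ :=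
  ∑ l ∈ Finset.univ.filter (fun l : Fin n => l.val < k), s l

/-- The walks with `n` steps taken from `S` that start at the origin and stay in the quarter plane
`ℕ × ℕ`, ending at `(i, j)`; a walk is given by its sequence of steps. -/
def walks (S : Finset (ℤ × ℤ)) (i j n : ℕ) : Set (Fin n → ℤ × ℤ) :=
  {s | (∀ l, s l ∈ S) ∧ (∀ k ≤ n, 0 ≤ (position s k).1 ∧ 0 ≤ (position s k).2) ∧
    position s n = ((i : ℤ), (j : ℤ))}

/-- The Kreweras steps W, S, NE. -/
def krewerasSteps : Finset (ℤ × ℤ) := {(-1, 0), (0, -1), (1, 1)}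

/-- `q i j n` is the number of Kreweras walks of length `n` in the quarter plane that start at the
origin and end at `(i, j)`. -/
def q (i j n : ℕ) : ℕ := (walks krewerasSteps i j n).ncard

/-- The set that `q` counts is finite. -/
theorem walks_finite (S : Finset (ℤ × ℤ)) (i j n : ℕ) : (walks S i j n).Finite :=
  (Set.Finite.pi' (fun _ : Fin n => S.finite_toSet)).subset (fun _ hs => hs.1)

/-- A Kreweras walk of length `n` ends in `{0, …, n}²`, so that the sums below, over
`i, j ≤ n`, range over all possible endpoints. -/
theorem q_eq_zero {i j n : ℕ} (h : n < i ∨ n < j) : q i j n = 0 := by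
  have key : walks krewerasSteps i j n = ∅ := by
    rw [Set.eq_empty_iff_forall_notMem]
    rintro s ⟨hs, -, he⟩
    have hp : position s n = ∑ l, s l := by simp [position]
    have hb : ∀ l, (s l).1 ≤ 1 ∧ (s l).2 ≤ 1 := by
      intro l
      have hl := hs l
      simp only [krewerasSteps, Finset.mem_insert, Finset.mem_singleton] at hl
      rcases hl with hl | hl | hl <;> rw [hl] <;> norm_num
    have h1 : (∑ l, (s l).1) ≤ ∑ _l : Fin n, (1 : ℤ) := Finset.sum_le_sum fun l _ => (hb l).1
    have h2 : (∑ l, (s l).2) ≤ ∑ _l : Fin n, (1 : ℤ) := Finset.sum_le_sum fun l _ => (hb l).2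
    have e1 := congrArg Prod.fst (hp.symm.trans he)
    have e2 := congrArg Prod.snd (hp.symm.trans he)
    simp only [Prod.fst_sum, Prod.snd_sum] at e1 e2
    simp only [Finset.sum_const, Finset.card_univ, Fintype.card_fin, nsmul_eq_mul, mul_one]
      at h1 h2
    omega
  rw [q, key, Set.ncard_empty]

/-- `Q(x,y;t) = ∑ q(i,j;n) x^i y^j t^n`, a power series in `t` whose coefficients are polynomials
in `y` (outer variable) over `ℚ[x]` (inner variable). -/
def Q : PowerSeries (Polynomial (Polynomial ℚ)) :=
  PowerSeries.mk fun n => ∑ i ∈ Finset.range (n + 1), ∑ j ∈ Finset.range (n + 1),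
    Polynomial.monomial j (Polynomial.monomial i (q i j n : ℚ))

/-- `Q(x,0;t)`, the specialization `y = 0`. -/
def Qx0 : PowerSeries (Polynomial ℚ) :=
  PowerSeries.map (Polynomial.evalRingHom 0) Q

/-- `Q_d(x;t) = ∑ q(i,i;n) x^i t^n`. -/
def Qd : PowerSeries (Polynomial ℚ) :=
  PowerSeries.mk fun n => ∑ i ∈ Finset.range (n + 1), Polynomial.monomial i (q i i n : ℚ)

/-- The coefficient `[x^i] F(x;t)`, a power series in `t`. -/
def coeffX (i : ℕ) (F : PowerSeries (Polynomial ℚ)) : PowerSeries ℚ :=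
  PowerSeries.mk fun n => (PowerSeries.coeff n F).coeff i

/-- A series `F(t)` seen as a series in `t` over `ℚ[x]` that does not depend on `x`. -/
def lift (F : PowerSeries ℚ) : PowerSeries (Polynomial ℚ) :=
  PowerSeries.map Polynomial.C F

/-- The indeterminate `x` as a series in `t` over `ℚ[x]`. -/
def x : PowerSeries (Polynomial ℚ) := PowerSeries.C Polynomial.X

/-- For `F` with constant coefficient `1`, the square root of `F` with constant coefficient `1`,
that is, the binomial series `∑ choose (1/2) k * (F - 1)^k`. -/
def sqrt {A : Type*} [CommRing A] [Algebra ℚ A] (F : PowerSeries A) : PowerSeries A :=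
  (PowerSeries.binomialSeries A (1 / 2 : ℚ)).subst (F - 1)

theorem hasSubst_sub_one {A : Type*} [CommRing A] {F : PowerSeries A}
    (hF : PowerSeries.constantCoeff F = 1) : PowerSeries.HasSubst (F - 1) :=
  PowerSeries.HasSubst.of_constantCoeff_zero' (by simp [hF])

theorem sqrt_sq {A : Type*} [CommRing A] [Algebra ℚ A] {F : PowerSeries A}
    (hF : PowerSeries.constantCoeff F = 1) : sqrt F ^ 2 = F := by
  have h := hasSubst_sub_one hF
  have hb : PowerSeries.binomialSeries A (1 / 2 : ℚ) ^ 2 = 1 + PowerSeries.X := by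
    rw [sq, ← PowerSeries.binomialSeries_add]
    have := PowerSeries.binomialSeries_nat (R := ℚ) (A := A) 1
    norm_num at this ⊢
    exact this
  rw [sqrt, ← PowerSeries.subst_pow h, hb, ← PowerSeries.coe_substAlgHom h, map_add, map_one,
    PowerSeries.substAlgHom_X]
  ring

theorem constantCoeff_sqrt {A : Type*} [CommRing A] [Algebra ℚ A] {F : PowerSeries A}
    (hF : PowerSeries.constantCoeff F = 1) : PowerSeries.constantCoeff (sqrt F) = 1 := by
  have h0 : PowerSeries.constantCoeff (F - 1) = 0 := by simp [hF]
  have h := PowerSeries.constantCoeff_subst_eq_zero h0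
    (PowerSeries.binomialSeries A (1 / 2 : ℚ) - 1) (by simp)
  rw [← PowerSeries.coe_substAlgHom (hasSubst_sub_one hF), map_sub, map_one,
    PowerSeries.coe_substAlgHom] at h
  change PowerSeries.constantCoeff (sqrt F - 1) = 0 at h
  rw [map_sub, map_one] at h
  exact sub_eq_zero.mp h

/-- The inclusion of `ℚ[x][[t]]` in the field `ℚ(x)((t))` of Laurent series in `t` over `ℚ(x)`. -/
def incl : PowerSeries (Polynomial ℚ) →+* LaurentSeries (RatFunc ℚ) :=
  (HahnSeries.ofPowerSeries ℤ (RatFunc ℚ)).comp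
    (PowerSeries.map (algebraMap (Polynomial ℚ) (RatFunc ℚ)))

/-- The inclusion of `ℚ[[t]]` in the field `ℚ((t))`. -/
def incl₀ : PowerSeries ℚ →+* LaurentSeries ℚ := HahnSeries.ofPowerSeries ℤ ℚ

end QuarterPlane

end

noncomputable section

namespace QuarterPlane

/-! The series `Q(x,0)` is found by guess and check. Deleting the last step turns the walks into the
functional equation `K Q(x,y) = xy - tx Q(x,0) - ty Q(0,y)` with kernel `K = xy - t(x + y + x²y²)`.
Conversely, any series `G` and `P` with `K G = xy - tx P(x) - ty P(y)` must be `Q` and `Q(x,0)`,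
because comparing coefficients reproduces the recurrence of the counts
(`eq_Qx0_of_functional_equation`). So it suffices to exhibit one `P` for which `K` divides the
right-hand side. With `c = 1 + (xW²/4)c²` the choice is `P = (2 + W³)(4c - W³c²)/8`. In terms of
`W`, `c(x)` and `c(y)` everything is rational, and the divisibility is an explicit identity
(`kernel_identity_field`). This gives `Qx0_eq`.

Then (1) holds because `√(1 - xW²) = 1 - xW²c/2`, (2) because the coefficients of `c` are Catalan
numbers up to powers of `W²/4`, and (3) by the coefficients of the powers of `W` (`coeff_W_pow`).

For (4), walks ending on or below the diagonal satisfy a second functional equation, whose unknowns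
are `Q_d` and `Q(x,0)`. Since `Q(x,0)` is quadratic over the series free of `x`, it can be
eliminated modulo the new kernel; what remains is a multiple of `s²`, where `s` marks the distance
to the diagonal. Such a multiple must vanish (`eq_zero_of_diagonal_kernel_mul`), which leaves an
equation for `(1 - txQ_d)²`. -/

/-! ### Recurrence by deletion of the last step -/

theorem position_snoc_of_le {n : ℕ} (s : Fin n → ℤ × ℤ) (σ : ℤ × ℤ) {k : ℕ} (hk : k ≤ n) :
    position (Fin.snoc s σ : Fin (n + 1) → ℤ × ℤ) k = position s k := by
  simp only [position, Finset.sum_filter, Fin.sum_univ_castSucc, Fin.snoc_castSucc, Fin.snoc_last,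
    Fin.val_castSucc, Fin.val_last]
  rw [if_neg (by omega), add_zero]

theorem position_snoc_last {n : ℕ} (s : Fin n → ℤ × ℤ) (σ : ℤ × ℤ) :
    position (Fin.snoc s σ : Fin (n + 1) → ℤ × ℤ) (n + 1) = position s n + σ := by
  simp [position, Finset.sum_filter, Fin.sum_univ_castSucc]

/-- Positivity is only asked up to time `n`: at time `n + 1` it follows from `i` and `j` being
natural numbers. -/
theorem snoc_mem_walks {S : Finset (ℤ × ℤ)} {i j n : ℕ} {s : Fin n → ℤ × ℤ} {σ : ℤ × ℤ} :
    (Fin.snoc s σ : Fin (n + 1) → ℤ × ℤ) ∈ walks S i j (n + 1) ↔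
      σ ∈ S ∧ (∀ l, s l ∈ S) ∧ (∀ k ≤ n, 0 ≤ (position s k).1 ∧ 0 ≤ (position s k).2) ∧
        position s n + σ = ((i : ℤ), (j : ℤ)) := by
  simp only [walks, Set.mem_ofPred_eq, Fin.forall_fin_succ', Fin.snoc_castSucc, Fin.snoc_last,
    position_snoc_last]
  constructor
  · rintro ⟨⟨h1, h2⟩, h3, h4⟩
    refine ⟨h2, h1, fun k hk => ?_, h4⟩
    rw [← position_snoc_of_le s σ hk]
    exact h3 k (by omega)
  · rintro ⟨h2, h1, h3, h4⟩
    refine ⟨⟨h1, h2⟩, fun k hk => ?_, h4⟩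
    rcases Nat.lt_or_ge n k with h | h
    · obtain rfl : k = n + 1 := by omega
      rw [position_snoc_last, h4]
      simp
    · rw [position_snoc_of_le s σ h]
      exact h3 k h

theorem ncard_walks_last {S : Finset (ℤ × ℤ)} {σ : ℤ × ℤ} (hσ : σ ∈ S) {i j i' j' n : ℕ}
    (hi : (i' : ℤ) + σ.1 = i) (hj : (j' : ℤ) + σ.2 = j) :
    {s ∈ walks S i j (n + 1) | s (Fin.last n) = σ}.ncard = (walks S i' j' n).ncard := by
  have himg : {s ∈ walks S i j (n + 1) | s (Fin.last n) = σ} =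
      (fun s : Fin n → ℤ × ℤ => (Fin.snoc s σ : Fin (n + 1) → ℤ × ℤ)) '' walks S i' j' n := by
    ext s
    constructor
    · rintro ⟨hs, hl⟩
      rw [← Fin.snoc_init_self s, hl, snoc_mem_walks] at hs
      refine ⟨Fin.init s, ⟨hs.2.1, hs.2.2.1, ?_⟩, by rw [← hl]; exact Fin.snoc_init_self s⟩
      have h := hs.2.2.2
      rw [Prod.ext_iff] at h ⊢
      simp only [Prod.fst_add, Prod.snd_add] at h ⊢
      omega
    · rintro ⟨s, hs, rfl⟩
      refine ⟨snoc_mem_walks.2 ⟨hσ, hs.1, hs.2.1, ?_⟩, by simp⟩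
      rw [hs.2.2]
      ext <;> simpa
  rw [himg, Set.ncard_image_of_injective]
  intro s s' h
  simpa using congrArg Fin.init h

theorem ncard_walks_last_eq_zero {S : Finset (ℤ × ℤ)} {σ : ℤ × ℤ} {i j n : ℕ}
    (h : (i : ℤ) < σ.1 ∨ (j : ℤ) < σ.2) :
    {s ∈ walks S i j (n + 1) | s (Fin.last n) = σ}.ncard = 0 := by
  have hempty : {s ∈ walks S i j (n + 1) | s (Fin.last n) = σ} = ∅ := by
    rw [Set.eq_empty_iff_forall_notMem]
    rintro s ⟨hs, hl⟩
    rw [← Fin.snoc_init_self s, hl, snoc_mem_walks] at hs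
    have h1 := hs.2.2.1 n le_rfl
    have h2 := hs.2.2.2
    rw [Prod.ext_iff] at h2
    simp only [Prod.fst_add, Prod.snd_add] at h2
    omega
  rw [hempty, Set.ncard_empty]

theorem q_succ_eq_sum (i j n : ℕ) : q i j (n + 1) =
    {s ∈ walks krewerasSteps i j (n + 1) | s (Fin.last n) = (-1, 0)}.ncard +
    {s ∈ walks krewerasSteps i j (n + 1) | s (Fin.last n) = (0, -1)}.ncard +
    {s ∈ walks krewerasSteps i j (n + 1) | s (Fin.last n) = (1, 1)}.ncard := by
  have hfin := walks_finite krewerasSteps i j (n + 1)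
  rw [← Set.ncard_union_eq _ (hfin.subset (Set.sep_subset _ _)) (hfin.subset (Set.sep_subset _ _)),
    ← Set.ncard_union_eq _ ((hfin.subset (Set.sep_subset _ _)).union
      (hfin.subset (Set.sep_subset _ _))) (hfin.subset (Set.sep_subset _ _)), q]
  · congr 1
    ext s
    simp only [Set.mem_union, Set.mem_ofPred_eq, ← and_or_left]
    refine ⟨fun hs => ⟨hs, ?_⟩, fun hs => hs.1⟩
    have := hs.1 (Fin.last n)
    simpa [krewerasSteps, or_assoc] using this
  · rw [Set.disjoint_left]
    rintro s (⟨-, h1⟩ | ⟨-, h1⟩) ⟨-, h2⟩ <;> rw [h1] at h2 <;> simp at h2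
  · rw [Set.disjoint_left]
    rintro s ⟨-, h1⟩ ⟨-, h2⟩
    rw [h1] at h2
    simp at h2

/-- The number of walks arriving at `(i, j)` by a North-East step. -/
theorem q_succ_succ_succ (i j n : ℕ) :
    q (i + 1) (j + 1) (n + 1) = q (i + 2) (j + 1) n + q (i + 1) (j + 2) n + q i j n := by
  rw [q_succ_eq_sum, ncard_walks_last (i' := i + 2) (j' := j + 1),
    ncard_walks_last (i' := i + 1) (j' := j + 2), ncard_walks_last (i' := i) (j' := j)]
  · rfl
  all_goals simp [krewerasSteps]
  all_goals ring

theorem q_succ_of_eq_zero {i j : ℕ} (h : i = 0 ∨ j = 0) (n : ℕ) :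
    q i j (n + 1) = q (i + 1) j n + q i (j + 1) n := by
  rw [q_succ_eq_sum, ncard_walks_last (i' := i + 1) (j' := j),
    ncard_walks_last (i' := i) (j' := j + 1), ncard_walks_last_eq_zero]
  · rfl
  · rcases h with rfl | rfl <;> simp
  all_goals simp [krewerasSteps]

theorem q_zero (i j : ℕ) : q i j 0 = if i = 0 ∧ j = 0 then 1 else 0 := by
  split_ifs with h
  · obtain ⟨rfl, rfl⟩ := h
    have : walks krewerasSteps 0 0 0 = Set.univ := by
      ext s
      simp [walks, position, Prod.zero_eq_mk]
    rw [q, this, Set.ncard_univ]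
    simp
  · exact q_eq_zero (by omega)

/-- The recurrence obtained by deleting the last step, with the initial condition, determines the
numbers `q i j n`. -/
theorem eq_q_of_recurrence {f : ℕ → ℕ → ℕ → ℚ}
    (h0 : ∀ i j, f i j 0 = if i = 0 ∧ j = 0 then 1 else 0)
    (h1 : ∀ i j n, f (i + 1) (j + 1) (n + 1) =
      f (i + 2) (j + 1) n + f (i + 1) (j + 2) n + f i j n)
    (h2 : ∀ i j n, i = 0 ∨ j = 0 → f i j (n + 1) = f (i + 1) j n + f i (j + 1) n)
    (i j n : ℕ) : f i j n = q i j n := by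
  induction n generalizing i j with
  | zero => rw [h0, q_zero]; push_cast; rfl
  | succ n ih =>
    rcases i with _ | i
    · rw [h2 _ _ _ (Or.inl rfl), q_succ_of_eq_zero (Or.inl rfl), ih, ih]; push_cast; rfl
    rcases j with _ | j
    · rw [h2 _ _ _ (Or.inr rfl), q_succ_of_eq_zero (Or.inr rfl), ih, ih]; push_cast; rfl
    rw [h1, q_succ_succ_succ, ih, ih, ih]; push_cast; rfl

/-- The recurrence and its initial condition are symmetric in the two coordinates, so uniqueness of
the solution suffices. -/
theorem q_comm (i j n : ℕ) : q i j n = q j i n := by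
  have := eq_q_of_recurrence (f := fun i j n => q j i n) (fun i j => ?_) (fun i j n => ?_)
    (fun i j n h => ?_) i j n
  · exact_mod_cast this.symm
  · simp only [q_zero, and_comm]; push_cast; rfl
  · simp only [q_succ_succ_succ]; push_cast; ring
  · simp only [q_succ_of_eq_zero h.symm]; push_cast; ring

/-! ### Algebraic equations solved by contraction -/

open PowerSeries in
/-- A contracting self-map of `R⟦X⟧` has a fixed point. -/
theorem exists_eq_of_contracting {R : Type*} [CommRing R] (Ψ : R⟦X⟧ → R⟦X⟧)
    (h : ∀ n f g, (X : R⟦X⟧) ^ n ∣ f - g → (X : R⟦X⟧) ^ (n + 1) ∣ Ψ f - Ψ g) :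
    ∃ f, f = Ψ f := by
  have hstep : ∀ n k, (X : R⟦X⟧) ^ n ∣ Ψ^[n + k] 0 - Ψ^[n] 0 := by
    intro n
    induction n with
    | zero => simp
    | succ n ih =>
      intro k
      rw [show n + 1 + k = (n + k) + 1 by ring, Function.iterate_succ_apply',
        Function.iterate_succ_apply']
      exact h _ _ _ (ih k)
  let f : R⟦X⟧ := mk fun n => coeff n (Ψ^[n + 1] 0)
  have hf : ∀ n, (X : R⟦X⟧) ^ n ∣ f - Ψ^[n] 0 := by
    intro n
    rw [X_pow_dvd_iff]
    intro m hm
    obtain ⟨k, rfl⟩ := Nat.exists_eq_add_of_lt hm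
    have := X_pow_dvd_iff.1 (hstep (m + 1) k) m (by omega)
    rw [map_sub, sub_eq_zero] at this ⊢
    rw [show m + k + 1 = m + 1 + k by ring, this, coeff_mk]
  refine ⟨f, ?_⟩
  ext n
  have h1 := X_pow_dvd_iff.1 (hf (n + 1)) n (by omega)
  have h2 := X_pow_dvd_iff.1 (h n _ _ (hf n)) n (by omega)
  rw [← Function.iterate_succ_apply' Ψ] at h2
  rw [map_sub, sub_eq_zero] at h1 h2
  rw [h1, h2]

theorem existsUnique_W : ∃! W : PowerSeries ℚ, W = PowerSeries.X * (2 + W ^ 3) := by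
  obtain ⟨W, hW⟩ := exists_eq_of_contracting (R := ℚ)
    (fun W => PowerSeries.X * (2 + W ^ 3)) (fun n f g hfg => by
      obtain ⟨a, ha⟩ := hfg
      exact ⟨a * (f ^ 2 + f * g + g ^ 2),
        by linear_combination PowerSeries.X * (f ^ 2 + f * g + g ^ 2) * ha⟩)
  refine ⟨W, hW, fun W' hW' => ?_⟩
  -- The second factor has constant term `1`, so it cannot vanish.
  have hprod : (W' - W) * (1 - PowerSeries.X * (W' ^ 2 + W' * W + W ^ 2)) = 0 := by
    linear_combination hW' - hW
  rcases mul_eq_zero.1 hprod with h | h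
  · exact sub_eq_zero.1 h
  · simpa using congrArg PowerSeries.constantCoeff h

theorem exists_catalan_equation {R : Type*} [CommRing R] {z : PowerSeries R}
    (hz : PowerSeries.X ∣ z) : ∃ c : PowerSeries R, c = 1 + z * c ^ 2 := by
  obtain ⟨w, rfl⟩ := hz
  refine exists_eq_of_contracting _ fun n f g hfg => ?_
  obtain ⟨a, ha⟩ := hfg
  exact ⟨a * w * (f + g), by linear_combination PowerSeries.X * w * (f + g) * ha⟩

/-! ### The kernel in Catalan coordinates -/

/-- The rational identity behind the solution of the functional equation: on the curves
`4 c = 4 + x W² c²` and `4 d = 4 + y W² d²`, the kernel divides `x y - R(x) - R(y)`. -/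
theorem kernel_identity_field {K : Type*} [Field K] {x y W c d : K}
    (hW : W ≠ 0) (hc0 : c ≠ 0) (hd0 : d ≠ 0)
    (hc : 4 * c = 4 + x * W ^ 2 * c ^ 2) (hd : 4 * d = 4 + y * W ^ 2 * d ^ 2) :
    (x * y * (2 + W ^ 3) - W * (x + y + x ^ 2 * y ^ 2)) * (4 - W ^ 3 * c * d) * 8 =
      (8 * x * y - W * x * (4 * c - W ^ 3 * c ^ 2) - W * y * (4 * d - W ^ 3 * d ^ 2)) *
      (8 - 2 * x * W ^ 2 * c - 2 * y * W ^ 2 * d - x * y * W * (4 - W ^ 3 * c * d)) := by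
  -- The curves are rational: solving for `x` and `y` instead of `c` and `d` leaves an identity of
  -- rational functions in the free variables `W`, `c`, `d`.
  have hx : x = 4 * (c - 1) / (W ^ 2 * c ^ 2) := by
    field_simp
    linear_combination -hc
  have hy : y = 4 * (d - 1) / (W ^ 2 * d ^ 2) := by
    field_simp
    linear_combination -hd
  subst hx hy
  field_simp
  ring

theorem kernel_identity_of_injective {R K : Type*} [CommRing R] [Field K] (f : R →+* K)
    (hf : Function.Injective f) {x y W c d : R} (hW : W ≠ 0) (hc0 : c ≠ 0) (hd0 : d ≠ 0)
    (hc : 4 * c = 4 + x * W ^ 2 * c ^ 2) (hd : 4 * d = 4 + y * W ^ 2 * d ^ 2) :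
    (x * y * (2 + W ^ 3) - W * (x + y + x ^ 2 * y ^ 2)) * (4 - W ^ 3 * c * d) * 8 =
      (8 * x * y - W * x * (4 * c - W ^ 3 * c ^ 2) - W * y * (4 * d - W ^ 3 * d ^ 2)) *
      (8 - 2 * x * W ^ 2 * c - 2 * y * W ^ 2 * d - x * y * W * (4 - W ^ 3 * c * d)) := by
  have hne : ∀ {a : R}, a ≠ 0 → f a ≠ 0 := fun h => by rwa [Ne, map_eq_zero_iff _ hf]
  apply hf
  have := kernel_identity_field (hne hW) (hne hc0) (hne hd0) (x := f x) (y := f y)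
    (by simpa [map_ofNat] using congrArg f hc) (by simpa [map_ofNat] using congrArg f hd)
  simpa [map_ofNat] using this

/-- Since `t(2 + W³) = W`, the kernel identity is `2 + W³` times the kernel on one side and `8(xy -
txP - tyP')` on the other. Its two cofactors form the fraction that `hG` names `G`, the candidate
for `Q(x,y)`. -/
theorem functional_equation_of_catalan {R : Type*} [CommRing R] [IsDomain R]
    {x y t W c d G P P' : R} (h2 : (2 : R) ≠ 0) (hW : W = t * (2 + W ^ 3))
    (hW0 : W ≠ 0) (hc : 4 * c = 4 + x * W ^ 2 * c ^ 2) (hd : 4 * d = 4 + y * W ^ 2 * d ^ 2)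
    (hP : 8 * P = (2 + W ^ 3) * (4 * c - W ^ 3 * c ^ 2))
    (hP' : 8 * P' = (2 + W ^ 3) * (4 * d - W ^ 3 * d ^ 2))
    (hD : 8 - 2 * x * W ^ 2 * c - 2 * y * W ^ 2 * d - x * y * W * (4 - W ^ 3 * c * d) ≠ 0)
    (hG : (8 - 2 * x * W ^ 2 * c - 2 * y * W ^ 2 * d - x * y * W * (4 - W ^ 3 * c * d)) * G =
      (2 + W ^ 3) * (4 - W ^ 3 * c * d)) :
    (x * y - t * (x + y + x ^ 2 * y ^ 2)) * G = x * y - t * x * P - t * y * P' := by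
  have h4 : (4 : R) ≠ 0 := by
    rw [show (4 : R) = 2 * 2 by norm_num]
    exact mul_ne_zero h2 h2
  have hc0 : c ≠ 0 := by
    rintro rfl
    exact h4 (by linear_combination -hc)
  have hd0 : d ≠ 0 := by
    rintro rfl
    exact h4 (by linear_combination -hd)
  have key := kernel_identity_of_injective (algebraMap R (FractionRing R))
    (IsFractionRing.injective R (FractionRing R)) hW0 hc0 hd0 hc hd
  set D := 8 - 2 * x * W ^ 2 * c - 2 * y * W ^ 2 * d - x * y * W * (4 - W ^ 3 * c * d) with hDdef
  have h8 : (8 : R) ≠ 0 := by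
    rw [show (8 : R) = 4 * 2 by norm_num]
    exact mul_ne_zero h4 h2
  have e1 : W * (4 * c - W ^ 3 * c ^ 2) = 8 * t * P := by
    linear_combination (4 * c - W ^ 3 * c ^ 2) * hW - t * hP
  have e2 : W * (4 * d - W ^ 3 * d ^ 2) = 8 * t * P' := by
    linear_combination (4 * d - W ^ 3 * d ^ 2) * hW - t * hP'
  apply mul_left_cancel₀ (mul_ne_zero hD h8)
  linear_combination key + 8 * (x * y - t * (x + y + x ^ 2 * y ^ 2)) * hG
    + 8 * (4 - W ^ 3 * c * d) * (x + y + x ^ 2 * y ^ 2) * hW - D * x * e1 - D * y * e2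

/-! ### Coefficients in three variables, and uniqueness for the functional equation -/

/-- A series over `ℚ[x]` seen as a series over `ℚ[x][y]` that does not depend on `y`. -/
def inner : PowerSeries (Polynomial ℚ) →+* PowerSeries (Polynomial (Polynomial ℚ)) :=
  PowerSeries.map Polynomial.C

/-- The series over `ℚ[x][y]` obtained from a series over `ℚ[x]` by replacing `x` by `y`. -/
def outer : PowerSeries (Polynomial ℚ) →+* PowerSeries (Polynomial (Polynomial ℚ)) :=
  PowerSeries.map (Polynomial.mapRingHom Polynomial.C)

/-- The coefficient of `x^i y^j t^n`. -/
def coeff₃ (i j n : ℕ) (G : PowerSeries (Polynomial (Polynomial ℚ))) : ℚ :=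
  ((PowerSeries.coeff n G).coeff j).coeff i

theorem ext₃ {F G : PowerSeries (Polynomial (Polynomial ℚ))}
    (h : ∀ i j n, coeff₃ i j n F = coeff₃ i j n G) : F = G := by
  ext n j i
  exact h i j n

theorem coeff₃_add (i j n : ℕ) (F G : PowerSeries (Polynomial (Polynomial ℚ))) :
    coeff₃ i j n (F + G) = coeff₃ i j n F + coeff₃ i j n G := by
  simp [coeff₃]

theorem coeff₃_one (i j n : ℕ) :
    coeff₃ i j n 1 = if i = 0 ∧ j = 0 ∧ n = 0 then 1 else 0 := by
  rcases n with _ | n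
  · rcases j with _ | j
    · simp [coeff₃, Polynomial.coeff_one]
    · simp [coeff₃, Polynomial.coeff_one]
  · simp [coeff₃, PowerSeries.coeff_one]

theorem coeff₃_inner (i j n : ℕ) (P : PowerSeries (Polynomial ℚ)) :
    coeff₃ i j n (inner P) = if j = 0 then (PowerSeries.coeff n P).coeff i else 0 := by
  rcases j with _ | j <;> simp [coeff₃, inner, Polynomial.coeff_C]

theorem coeff₃_outer (i j n : ℕ) (P : PowerSeries (Polynomial ℚ)) :
    coeff₃ i j n (outer P) = if i = 0 then (PowerSeries.coeff n P).coeff j else 0 := by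
  rcases i with _ | i <;> simp [coeff₃, outer, Polynomial.coeff_C]

section

variable (i j n : ℕ) (G : PowerSeries (Polynomial (Polynomial ℚ)))

theorem coeff₃_zero_x_mul : coeff₃ 0 j n (inner x * G) = 0 := by
  simp [coeff₃, inner, x, PowerSeries.coeff_C_mul]

theorem coeff₃_succ_x_mul : coeff₃ (i + 1) j n (inner x * G) = coeff₃ i j n G := by
  simp [coeff₃, inner, x, PowerSeries.coeff_C_mul]

theorem coeff₃_zero_y_mul : coeff₃ i 0 n (outer x * G) = 0 := by
  simp [coeff₃, outer, x, PowerSeries.coeff_C_mul]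

theorem coeff₃_succ_y_mul : coeff₃ i (j + 1) n (outer x * G) = coeff₃ i j n G := by
  simp [coeff₃, outer, x, PowerSeries.coeff_C_mul]

theorem coeff₃_zero_t_mul : coeff₃ i j 0 (PowerSeries.X * G) = 0 := by
  simp [coeff₃]

theorem coeff₃_succ_t_mul : coeff₃ i j (n + 1) (PowerSeries.X * G) = coeff₃ i j n G := by
  simp [coeff₃, PowerSeries.coeff_succ_X_mul]

end

theorem inner_X : inner PowerSeries.X = PowerSeries.X := PowerSeries.map_X _

theorem outer_X : outer PowerSeries.X = PowerSeries.X := PowerSeries.map_X _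

theorem outer_lift (F : PowerSeries ℚ) : outer (lift F) = inner (lift F) := by
  ext n : 1
  simp [outer, inner, lift]

theorem inner_injective : Function.Injective inner :=
  PowerSeries.map_injective _ Polynomial.C_injective

theorem lift_injective : Function.Injective lift :=
  PowerSeries.map_injective _ Polynomial.C_injective

theorem coeff_Qx0 (i n : ℕ) : (PowerSeries.coeff n Qx0).coeff i = q i 0 n := by
  have h : ∀ k, k < n + 1 ∨ (q k 0 n : ℚ) = 0 := fun k => by
    by_cases hk : k < n + 1
    · exact Or.inl hk
    · exact Or.inr (by rw [q_eq_zero (Or.inl (by omega))]; rfl)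
  simp only [Qx0, Q, PowerSeries.coeff_map, PowerSeries.coeff_mk, map_sum,
    Polynomial.coe_evalRingHom, Polynomial.eval_monomial, Polynomial.finsetSum_coeff,
    zero_pow_eq, mul_ite, mul_one, mul_zero, Finset.sum_ite_eq', Finset.mem_range,
    Nat.succ_pos, if_true, Polynomial.coeff_monomial]
  rw [ite_eq_left_iff]
  rcases h i with h | h <;> simp [h]

theorem coeff_Qd (i n : ℕ) : (PowerSeries.coeff n Qd).coeff i = q i i n := by
  simp only [Qd, PowerSeries.coeff_mk, Polynomial.finsetSum_coeff, Polynomial.coeff_monomial,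
    Finset.sum_ite_eq', Finset.mem_range, ite_eq_left_iff]
  intro h
  rw [q_eq_zero (Or.inl (by omega))]
  rfl

/-- At monomials divisible by `xy` the terms in `P` only matter on the boundary of coefficient
extraction and drop out, so `G` obeys the recurrence of the counts. The coefficients of `y^0` then
give `P = G(x,0)`. No relation between `P` and `G` has to be assumed beyond the equation. -/
theorem eq_Qx0_of_functional_equation {G : PowerSeries (Polynomial (Polynomial ℚ))}
    {P : PowerSeries (Polynomial ℚ)}
    (h : (inner x * outer x - PowerSeries.X * (inner x + outer x + inner x ^ 2 * outer x ^ 2)) * G =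
      inner x * outer x - PowerSeries.X * inner x * inner P - PowerSeries.X * outer x * outer P) :
    P = Qx0 := by
  have h' : inner x * (outer x * G) + PowerSeries.X * (inner x * inner P) +
      PowerSeries.X * (outer x * outer P) = inner x * (outer x * 1) +
      PowerSeries.X * (inner x * G) + PowerSeries.X * (outer x * G) +
      PowerSeries.X * (outer x * (outer x * (inner x * (inner x * G)))) := by
    linear_combination h
  have hcoeff := fun i j n => congrArg (coeff₃ i j n) h'
  simp only [coeff₃_add] at hcoeff
  have hGq : ∀ i j n, coeff₃ i j n G = q i j n := by
    refine eq_q_of_recurrence (fun i j => ?_) (fun i j n => ?_) (fun i j n hij => ?_)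
    · have := hcoeff (i + 1) (j + 1) 0
      simp only [coeff₃_succ_x_mul, coeff₃_succ_y_mul, coeff₃_zero_t_mul, coeff₃_one] at this
      simpa using this
    · have := hcoeff (i + 2) (j + 2) (n + 1)
      simp only [coeff₃_succ_x_mul, coeff₃_succ_y_mul, coeff₃_succ_t_mul, coeff₃_one,
        coeff₃_inner, coeff₃_outer] at this
      simp at this
      linarith
    · have := hcoeff (i + 1) (j + 1) (n + 1)
      simp only [coeff₃_succ_x_mul, coeff₃_succ_y_mul, coeff₃_succ_t_mul, coeff₃_one,
        coeff₃_inner, coeff₃_outer] at this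
      rcases hij with rfl | rfl
      · rcases j with _ | j <;>
        simp [coeff₃_succ_y_mul, coeff₃_zero_x_mul, coeff₃_succ_x_mul, coeff₃_zero_y_mul]
          at this ⊢ <;> linarith
      · simp [coeff₃_zero_y_mul] at this ⊢
        linarith
  ext n i
  have := hcoeff (i + 1) 0 (n + 1)
  simp only [coeff₃_succ_x_mul, coeff₃_zero_y_mul, coeff₃_succ_t_mul, coeff₃_inner] at this
  simp at this
  rw [coeff_Qx0, this, hGq]

/-! ### The closed form of `Q(x,0)` -/

theorem ne_zero_of_eq {W : PowerSeries ℚ} (hW : W = PowerSeries.X * (2 + W ^ 3)) : W ≠ 0 := by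
  rintro rfl
  simpa [map_ofNat] using congrArg (PowerSeries.coeff 1) hW

theorem lift_eq {W : PowerSeries ℚ} (hW : W = PowerSeries.X * (2 + W ^ 3)) :
    lift W = PowerSeries.X * (2 + lift W ^ 3) := by
  have := congrArg (PowerSeries.map (Polynomial.C : ℚ →+* _)) hW
  simpa [lift, map_ofNat] using this

/-- Over `ℚ[x]` there is a series `c` with `c = 1 + (x W² / 4) c²`. -/
theorem exists_catalan_series {W : PowerSeries ℚ} (hW : W = PowerSeries.X * (2 + W ^ 3)) :
    ∃ c : PowerSeries (Polynomial ℚ), 4 * c = 4 + x * lift W ^ 2 * c ^ 2 := by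
  obtain ⟨c, hc⟩ := exists_catalan_equation
    (z := (algebraMap ℚ (PowerSeries (Polynomial ℚ)) (1 / 4)) * (x * lift W ^ 2))
    (Dvd.dvd.mul_left (Dvd.dvd.mul_left (dvd_pow (Dvd.intro _ (lift_eq hW).symm) two_ne_zero) _) _)
  have h4 : 4 * (algebraMap ℚ (PowerSeries (Polynomial ℚ)) (1 / 4)) = 1 := by
    rw [show (4 : PowerSeries (Polynomial ℚ)) = algebraMap ℚ _ 4 by simp [map_ofNat], ← map_mul]
    norm_num
  refine ⟨c, ?_⟩
  linear_combination 4 * hc + x * lift W ^ 2 * c ^ 2 * h4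

theorem two_ne_zero₃ : (2 : PowerSeries (Polynomial (Polynomial ℚ))) ≠ 0 := fun h =>
  two_ne_zero (α := ℚ) (by
    simpa [coeff₃, ← map_ofNat PowerSeries.C, ← map_ofNat Polynomial.C]
      using congrArg (coeff₃ 0 0 0) h)

theorem Qx0_eq {W : PowerSeries ℚ} (hW : W = PowerSeries.X * (2 + W ^ 3))
    {c : PowerSeries (Polynomial ℚ)} (hc : 4 * c = 4 + x * lift W ^ 2 * c ^ 2) :
    8 * Qx0 = (2 + lift W ^ 3) * (4 * c - lift W ^ 3 * c ^ 2) := by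
  obtain ⟨P, hP⟩ : ∃ P, 8 * P = (2 + lift W ^ 3) * (4 * c - lift W ^ 3 * c ^ 2) := by
    refine ⟨algebraMap ℚ (PowerSeries (Polynomial ℚ)) (1 / 8) *
      ((2 + lift W ^ 3) * (4 * c - lift W ^ 3 * c ^ 2)), ?_⟩
    rw [← mul_assoc, show (8 : PowerSeries (Polynomial ℚ)) = algebraMap ℚ _ 8 by simp [map_ofNat],
      ← map_mul]
    norm_num
  have hW' : inner (lift W) = PowerSeries.X * (2 + inner (lift W) ^ 3) := by
    have := congrArg inner (lift_eq hW)
    simpa [map_ofNat, inner_X] using this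
  have hc0 : PowerSeries.constantCoeff (inner (lift W)) = 0 := by
    rw [hW']
    simp
  -- At `t = 0` one has `W = 0`, and the denominator reduces to `8`; hence the candidate for
  -- `Q(x,y)` is a genuine power series.
  have hDu : IsUnit (8 - 2 * inner x * inner (lift W) ^ 2 * inner c -
      2 * outer x * inner (lift W) ^ 2 * outer c -
      inner x * outer x * inner (lift W) * (4 - inner (lift W) ^ 3 * inner c * outer c)) := by
    rw [PowerSeries.isUnit_iff_constantCoeff]
    simp only [map_sub, map_mul, map_pow, hc0, map_ofNat]
    have h8 : IsUnit (algebraMap ℚ (Polynomial (Polynomial ℚ)) 8) :=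
      (IsUnit.mk0 (8 : ℚ) (by norm_num)).map _
    simpa [map_ofNat] using h8
  obtain ⟨G, hG⟩ := hDu.dvd
    (a := (2 + inner (lift W) ^ 3) * (4 - inner (lift W) ^ 3 * inner c * outer c))
  have hfe := functional_equation_of_catalan (x := inner x) (y := outer x) (t := PowerSeries.X)
    (W := inner (lift W)) (c := inner c) (d := outer c) (G := G) (P := inner P) (P' := outer P)
    two_ne_zero₃ hW'
    (by
      rw [Ne, map_eq_zero_iff _ inner_injective]
      intro h
      exact ne_zero_of_eq hW (lift_injective (h.trans (map_zero _).symm)))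
    (by simpa [map_ofNat] using congrArg inner hc)
    (by simpa [map_ofNat, outer_lift] using congrArg outer hc)
    (by simpa [map_ofNat] using congrArg inner hP)
    (by simpa [map_ofNat, outer_lift] using congrArg outer hP)
    hDu.ne_zero hG.symm
  rw [← eq_Qx0_of_functional_equation hfe, hP]

/-- In a domain two square roots differ by a sign, and the constant term rules out the minus sign.
-/
theorem sqrt_eq {F G : PowerSeries (Polynomial ℚ)} (hG : PowerSeries.constantCoeff G = 1)
    (h : G ^ 2 = F) : sqrt F = G := by
  have hF : PowerSeries.constantCoeff F = 1 := by rw [← h, map_pow, hG, one_pow]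
  rcases sq_eq_sq_iff_eq_or_eq_neg.1 ((sqrt_sq hF).trans h.symm) with h1 | h1
  · exact h1
  · have h2 := congrArg PowerSeries.constantCoeff h1
    rw [constantCoeff_sqrt hF, map_neg, hG] at h2
    have h3 := congrArg (Polynomial.eval 0) h2
    norm_num at h3

/-- This is the quadratic formula for `c`: completing the square gives `(1 - xW²c/2)² = 1 - xW²`. -/
theorem sqrt_one_sub_eq {W : PowerSeries ℚ} (hW : W = PowerSeries.X * (2 + W ^ 3))
    {c : PowerSeries (Polynomial ℚ)} (hc : 4 * c = 4 + x * lift W ^ 2 * c ^ 2) :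
    2 * sqrt (1 - x * lift W ^ 2) = 2 - x * lift W ^ 2 * c := by
  have h2 : 2 * (algebraMap ℚ (PowerSeries (Polynomial ℚ)) (1 / 2)) = 1 := by
    rw [show (2 : PowerSeries (Polynomial ℚ)) = algebraMap ℚ _ 2 by simp [map_ofNat], ← map_mul]
    norm_num
  have hconst : PowerSeries.constantCoeff (lift W) = 0 := by
    rw [lift_eq hW]
    simp
  rw [sqrt_eq (G := 1 - algebraMap ℚ _ (1 / 2) * (x * lift W ^ 2 * c))]
  · linear_combination -(x * lift W ^ 2 * c) * h2
  · simp [hconst]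
  · generalize algebraMap ℚ (PowerSeries (Polynomial ℚ)) (1 / 2) = a at h2
    linear_combination (x * lift W ^ 2 * (c - 1) * (2 * a + 1) - x * lift W ^ 2 * c) * h2
      - a ^ 2 * x * lift W ^ 2 * hc

theorem incl_injective : Function.Injective incl := by
  intro F G h
  apply PowerSeries.map_injective _ (IsFractionRing.injective (Polynomial ℚ) (RatFunc ℚ))
  exact HahnSeries.ofPowerSeries_injective h

theorem incl₀_injective : Function.Injective incl₀ := HahnSeries.ofPowerSeries_injective

theorem charZero_laurentSeries (K : Type*) [Field K] [CharZero K] : CharZero (LaurentSeries K) :=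
  charZero_of_injective_ringHom (HahnSeries.C_injective (Γ := ℤ) (R := K))

theorem Qx0_formula_field {K : Type*} [Field K] [CharZero K] {t x w c r P : K} (ht : t ≠ 0)
    (hx : x ≠ 0) (hw0 : w ≠ 0) (hw : w = t * (2 + w ^ 3)) (hc : 4 * c = 4 + x * w ^ 2 * c ^ 2)
    (hr : 2 * r = 2 - x * w ^ 2 * c) (hP : 8 * P = (2 + w ^ 3) * (4 * c - w ^ 3 * c ^ 2)) :
    P = 1 / (t * x) * (1 / (2 * t) - 1 / x - (1 / w - 1 / x) * r) := by
  have hV : 2 + w ^ 3 ≠ 0 := by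
    intro h
    rw [h, mul_zero] at hw
    exact hw0 hw
  have ht' : t = w / (2 + w ^ 3) := by
    field_simp
    exact hw.symm
  have hr' : r = (2 - x * w ^ 2 * c) / 2 := by linear_combination hr / 2
  have hP' : P = (2 + w ^ 3) * (4 * c - w ^ 3 * c ^ 2) / 8 := by linear_combination hP / 8
  subst ht' hr' hP'
  field_simp
  linear_combination 2 * w ^ 3 * x * hc

theorem x_ne_zero : x ≠ 0 := by
  intro h
  have := congrArg (PowerSeries.coeff 0) h
  rw [x, PowerSeries.coeff_zero_C, map_zero] at this
  exact Polynomial.X_ne_zero this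

theorem incl_Qx0 {W : PowerSeries ℚ} (hW : W = PowerSeries.X * (2 + W ^ 3)) :
    incl Qx0 = 1 / (incl PowerSeries.X * incl x) * (1 / (2 * incl PowerSeries.X) - 1 / incl x -
      (1 / incl (lift W) - 1 / incl x) * incl (sqrt (1 - x * lift W ^ 2))) := by
  obtain ⟨c, hc⟩ := exists_catalan_series hW
  have hne : ∀ {F}, F ≠ 0 → incl F ≠ 0 := fun h => by rwa [Ne, map_eq_zero_iff _ incl_injective]
  have := charZero_laurentSeries (RatFunc ℚ)
  refine Qx0_formula_field (c := incl c) (hne PowerSeries.X_ne_zero) (hne ?_) (hne ?_) ?_ ?_ ?_ ?_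
  · exact x_ne_zero
  · intro h
    exact ne_zero_of_eq hW (lift_injective (h.trans (map_zero _).symm))
  · simpa [map_ofNat] using congrArg incl (lift_eq hW)
  · simpa [map_ofNat] using congrArg incl hc
  · simpa only [map_ofNat, map_mul, map_sub, map_pow] using congrArg incl (sqrt_one_sub_eq hW hc)
  · simpa [map_ofNat] using congrArg incl (Qx0_eq hW hc)

/-! ### Coefficients of powers of `x` in `Q(x,0)` -/

theorem coeffX_add (i : ℕ) (F G : PowerSeries (Polynomial ℚ)) :
    coeffX i (F + G) = coeffX i F + coeffX i G := by
  ext n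
  simp [coeffX]

theorem coeffX_mul (i : ℕ) (F G : PowerSeries (Polynomial ℚ)) :
    coeffX i (F * G) = ∑ p ∈ Finset.HasAntidiagonal.antidiagonal i, coeffX p.1 F * coeffX p.2 G := by
  ext n
  simp only [coeffX, PowerSeries.coeff_mk, PowerSeries.coeff_mul, map_sum,
    Polynomial.finsetSum_coeff, Polynomial.coeff_mul]
  exact Finset.sum_comm

theorem coeffX_lift (i : ℕ) (F : PowerSeries ℚ) : coeffX i (lift F) = if i = 0 then F else 0 := by
  ext n
  rcases i with _ | i <;> simp [coeffX, lift, Polynomial.coeff_C]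

theorem coeffX_lift_mul (i : ℕ) (F : PowerSeries ℚ) (G : PowerSeries (Polynomial ℚ)) :
    coeffX i (lift F * G) = F * coeffX i G := by
  ext n
  simp [coeffX, lift, PowerSeries.coeff_mul, Polynomial.finsetSum_coeff]

theorem coeffX_zero_x_mul (G : PowerSeries (Polynomial ℚ)) : coeffX 0 (x * G) = 0 := by
  ext n
  simp [coeffX, x, PowerSeries.coeff_C_mul]

theorem coeffX_succ_x_mul (i : ℕ) (G : PowerSeries (Polynomial ℚ)) :
    coeffX (i + 1) (x * G) = coeffX i G := by
  ext n
  simp [coeffX, x, PowerSeries.coeff_C_mul]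

/-- The coefficients of the solution of `c = 1 + (x W² / 4) c²`. -/
theorem coeffX_catalan_series {W : PowerSeries ℚ} {c : PowerSeries (Polynomial ℚ)}
    (hc : 4 * c = 4 + x * lift W ^ 2 * c ^ 2) (i : ℕ) :
    4 ^ i * coeffX i c = (catalan i : PowerSeries ℚ) * W ^ (2 * i) := by
  have h4 : (4 : PowerSeries ℚ) ≠ 0 := by
    intro h
    simpa [map_ofNat] using congrArg PowerSeries.constantCoeff h
  have hc' : lift 4 * c = lift 4 + x * (lift (W ^ 2) * (c * c)) := by
    simp only [lift, map_pow, map_ofNat] at hc ⊢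
    linear_combination hc
  induction i using Nat.strong_induction_on with
  | _ i ih =>
    have h := congrArg (coeffX i) hc'
    rcases i with _ | i
    · rw [coeffX_add, coeffX_zero_x_mul, coeffX_lift_mul, coeffX_lift, if_pos rfl] at h
      have : coeffX 0 c = 1 := mul_left_cancel₀ h4 (by linear_combination h)
      simp [this]
    · rw [coeffX_add, coeffX_succ_x_mul, coeffX_lift_mul, coeffX_lift_mul, coeffX_lift,
        if_neg (by omega), coeffX_mul] at h
      rw [pow_succ, mul_assoc, h, catalan_succ', Nat.cast_sum, Finset.sum_mul, zero_add,
        Finset.mul_sum, Finset.mul_sum]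
      refine Finset.sum_congr rfl fun p hp => ?_
      have hp' := Finset.HasAntidiagonal.mem_antidiagonal.1 hp
      have h1 := ih p.1 (by omega)
      have h2 := ih p.2 (by omega)
      rw [← hp', Nat.cast_mul]
      linear_combination W ^ 2 * 4 ^ p.2 * coeffX p.2 c * h1 +
        W ^ 2 * (catalan p.1 : PowerSeries ℚ) * W ^ (2 * p.1) * h2

/-- The equation of `c` gives `[x^i] c² = (4/W²)[x^(i+1)] c`, so the expression of `Q(x,0)` through
`c` and `c²` involves only two consecutive Catalan coefficients. -/
theorem coeffX_Qx0 {W : PowerSeries ℚ} (hW : W = PowerSeries.X * (2 + W ^ 3)) (i : ℕ) :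
    2 * 4 ^ (i + 1) * (PowerSeries.X * coeffX i Qx0) =
      4 * (catalan i : PowerSeries ℚ) * W ^ (2 * i + 1) -
        (catalan (i + 1) : PowerSeries ℚ) * W ^ (2 * i + 4) := by
  obtain ⟨c, hc⟩ := exists_catalan_series hW
  have h1 := coeffX_catalan_series hc i
  have h2 := coeffX_catalan_series hc (i + 1)
  have hQ : lift 8 * Qx0 + lift ((2 + W ^ 3) * W ^ 3) * (c ^ 2) =
      lift ((2 + W ^ 3) * 4) * c := by
    have := Qx0_eq hW hc
    simp only [lift, map_pow, map_ofNat, map_mul, map_add] at this ⊢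
    linear_combination this
  have hc' : lift 4 * c = lift 4 + x * (lift (W ^ 2) * (c ^ 2)) := by
    simp only [lift, map_pow, map_ofNat] at hc ⊢
    linear_combination hc
  have h3 := congrArg (coeffX i) hQ
  have h4 := congrArg (coeffX (i + 1)) hc'
  rw [coeffX_add, coeffX_lift_mul, coeffX_lift_mul, coeffX_lift_mul] at h3
  rw [coeffX_add, coeffX_succ_x_mul, coeffX_lift_mul, coeffX_lift_mul, coeffX_lift,
    if_neg (by omega)] at h4
  refine mul_left_cancel₀ (pow_ne_zero 2 (ne_zero_of_eq hW)) ?_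
  generalize coeffX i Qx0 = p at *
  generalize coeffX i (c ^ 2) = d at *
  linear_combination (exp := 1) 4 ^ i * W ^ 2 * PowerSeries.X * h3 + 4 * W ^ 3 * h1
    - W ^ 4 * h2 + (4 ^ i * W ^ 2 * (W ^ 3 * d - 4 * coeffX i c)) * hW + 4 ^ i * W ^ 4 * h4

theorem incl₀_coeffX_Qx0 {W : PowerSeries ℚ} (hW : W = PowerSeries.X * (2 + W ^ 3)) (i : ℕ) :
    incl₀ (coeffX i Qx0) = incl₀ W ^ (2 * i + 1) / (2 * 4 ^ i * incl₀ PowerSeries.X) *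
      ((catalan i : LaurentSeries ℚ) - (catalan (i + 1) : LaurentSeries ℚ) * incl₀ W ^ 3 / 4) := by
  have := charZero_laurentSeries ℚ
  have h := congrArg incl₀ (coeffX_Qx0 hW i)
  have hX : incl₀ PowerSeries.X ≠ 0 := by
    rw [Ne, map_eq_zero_iff _ incl₀_injective]
    exact PowerSeries.X_ne_zero
  simp only [map_mul, map_sub, map_pow, map_ofNat, map_natCast] at h
  field_simp
  linear_combination h

/-! ### Powers of `W` and the number of walks ending at `(i,0)` -/

theorem coeff_pow_eq_zero_of_lt {W : PowerSeries ℚ} (hW : W = PowerSeries.X * (2 + W ^ 3))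
    {n k : ℕ} (h : n < k) : PowerSeries.coeff n (W ^ k) = 0 := by
  have hdvd : PowerSeries.X ∣ W := Dvd.intro _ hW.symm
  exact PowerSeries.X_pow_dvd_iff.1 (pow_dvd_pow_of_dvd hdvd k) n h

theorem coeff_succ_pow_succ {W : PowerSeries ℚ} (hW : W = PowerSeries.X * (2 + W ^ 3))
    (n k : ℕ) : PowerSeries.coeff (n + 1) (W ^ (k + 1)) =
      2 * PowerSeries.coeff n (W ^ k) + PowerSeries.coeff n (W ^ (k + 3)) := by
  have h : W ^ (k + 1) = PowerSeries.X * (PowerSeries.C 2 * W ^ k + W ^ (k + 3)) := by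
    rw [map_ofNat]
    linear_combination W ^ k * hW
  rw [h, PowerSeries.coeff_succ_X_mul, map_add, PowerSeries.coeff_C_mul]

/-- The coefficients of the powers of `W`, as given by Lagrange inversion. -/
theorem coeff_W_pow {W : PowerSeries ℚ} (hW : W = PowerSeries.X * (2 + W ^ 3)) (k m : ℕ) :
    ((k + 3 * m : ℕ) : ℚ) * PowerSeries.coeff (k + 3 * m) (W ^ k) =
      k * (k + 3 * m).choose m * 2 ^ (k + 2 * m) := by
  generalize hn : k + 3 * m = n
  induction n generalizing k m with
  | zero =>
    obtain rfl : k = 0 := by omega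
    simp
  | succ n ih =>
    rcases k with _ | k
    · simp [PowerSeries.coeff_one]
    -- From `W^(k+1) = t(2W^k + W^(k+3))`, the pair `(k + 1, m)` is reduced to `(k, m)` and `(k + 3,
    -- m - 1)`, both with index sum `n`. For `m = 0` the second term vanishes.
    rw [coeff_succ_pow_succ hW]
    have h1 := ih k m (by omega)
    rcases m with _ | m
    · obtain rfl : k = n := by omega
      rw [coeff_pow_eq_zero_of_lt hW (show k < k + 3 by omega)]
      rcases k with _ | k
      · norm_num
      · have hk : ((k + 1 : ℕ) : ℚ) ≠ 0 := by positivity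
        have h2 := mul_left_cancel₀ hk
          (h1.trans (by simp : _ = ((k + 1 : ℕ) : ℚ) * 2 ^ (k + 1)))
        rw [h2, Nat.choose_zero_right]
        push_cast
        ring
    · have h2 := ih (k + 3) m (by omega)
      have hn0 : (n : ℚ) ≠ 0 := by
        rw [Nat.cast_ne_zero]
        omega
      have e1 : (n.choose m : ℚ) * (n + 1) = (n + 1).choose (m + 1) * (m + 1) := by
        exact_mod_cast (mul_comm _ _).trans (Nat.add_one_mul_choose_eq n m)
      have e2 : (n.choose (m + 1) : ℚ) * (n + 1) = (n + 1).choose (m + 1) * (n - m) := by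
        have := Nat.choose_mul_succ_eq n (m + 1)
        have h4 : ((n + 1 - (m + 1) : ℕ) : ℚ) = n - m := by
          rw [Nat.add_sub_add_right, Nat.cast_sub (by omega)]
        rw [← h4]
        exact_mod_cast this
      have e3 : (n : ℚ) = k + 3 * m + 3 := by
        have : n = k + 3 * m + 3 := by omega
        rw [this]
        push_cast
        ring
      apply mul_left_cancel₀ hn0
      rw [show k + 1 + 2 * (m + 1) = k + 2 * m + 3 by ring]
      rw [show k + 2 * (m + 1) = k + 2 * m + 2 by ring] at h1
      rw [show k + 3 + 2 * m = k + 2 * m + 3 by ring] at h2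
      push_cast at h1 h2 ⊢
      generalize (PowerSeries.coeff n) (W ^ k) = A at *
      generalize (PowerSeries.coeff n) (W ^ (k + 3)) = B at *
      generalize ((n + 1).choose (m + 1) : ℚ) = C at *
      rw [pow_add _ _ 3] at h2 ⊢
      rw [pow_add _ _ 2] at h1
      generalize (2 : ℚ) ^ (k + 2 * m) = D at *
      linear_combination 2 * ((n : ℚ) + 1) * h1 + ((n : ℚ) + 1) * h2 + 8 * k * D * e2
        + 8 * (k + 3) * D * e1 - 8 * C * D * e3

/-- The number of walks of length `3m + 2i` ending at `(i, 0)`. -/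
theorem q_eq (i m : ℕ) : (q i 0 (3 * m + 2 * i) : ℚ)
    = 4 ^ m * (2 * (i : ℚ) + 1) / (((m : ℚ) + i + 1) * (2 * (m : ℚ) + 2 * i + 1)) *
      (Nat.choose (2 * i) i : ℚ) * (Nat.choose (3 * m + 2 * i) m : ℚ) := by
  obtain ⟨W, hW, -⟩ := existsUnique_W
  set n := 3 * m + 2 * i with hn
  have hcoeff := congrArg (PowerSeries.coeff (n + 1)) (coeffX_Qx0 hW i)
  have hC : ∀ a : ℕ, (a : PowerSeries ℚ) = PowerSeries.C (a : ℚ) := fun a => by simp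
  rw [show (2 * 4 ^ (i + 1) : PowerSeries ℚ) = PowerSeries.C (2 * 4 ^ (i + 1)) by
      simp [map_ofNat],
    show (4 * (catalan i : PowerSeries ℚ)) = PowerSeries.C (4 * (catalan i : ℚ)) by
      simp [map_ofNat], hC (catalan (i + 1)), map_sub, PowerSeries.coeff_C_mul,
    PowerSeries.coeff_C_mul, PowerSeries.coeff_C_mul, PowerSeries.coeff_succ_X_mul, coeffX,
    PowerSeries.coeff_mk, coeff_Qx0] at hcoeff
  have h1 : ((n : ℚ) + 1) * PowerSeries.coeff (n + 1) (W ^ (2 * i + 1)) =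
      (2 * i + 1) * (n + 1).choose m * (4 ^ (i + m) * 2) := by
    have := coeff_W_pow hW (2 * i + 1) m
    rw [show 2 * i + 1 + 3 * m = n + 1 by omega,
      show 2 * i + 1 + 2 * m = 2 * (i + m) + 1 by ring, pow_succ 2, pow_mul 2] at this
    norm_num at this
    linear_combination this
  have e1 : (n.choose m : ℚ) * (n + 1) = (n + 1).choose m * (2 * m + 2 * i + 1) := by
    have := Nat.choose_mul_succ_eq n m
    rw [show n + 1 - m = 2 * m + 2 * i + 1 by omega] at this
    exact_mod_cast this
  -- Here `n + 1 = (2i + 4) + 3(m - 1)`, so the formula for powers is used at `m - 1`; the factor `m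
  -- + i + 1` comes from rewriting `choose (n+1) (m-1)` through `choose (n+1) m`. For `m = 0` both
  -- sides are zero.
  have h2 : ((n : ℚ) + 1) * (m + i + 1) * PowerSeries.coeff (n + 1) (W ^ (2 * i + 4)) =
      (2 * i + 4) * m * (n + 1).choose m * (4 ^ (i + m) * 2) := by
    rcases m with _ | m
    · rw [coeff_pow_eq_zero_of_lt hW (by omega)]
      simp
    · have := coeff_W_pow hW (2 * i + 4) m
      rw [show 2 * i + 4 + 3 * m = n + 1 by omega,
        show 2 * i + 4 + 2 * m = 2 * (i + (m + 1)) + 2 by ring, pow_add 2, pow_mul 2] at this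
      norm_num at this
      have e2 : ((n + 1).choose (m + 1) : ℚ) * (m + 1) =
          (n + 1).choose m * (2 * m + 2 * i + 4) := by
        have := Nat.choose_succ_right_eq (n + 1) m
        rw [show n + 1 - m = 2 * m + 2 * i + 4 by omega] at this
        exact_mod_cast this
      push_cast
      linear_combination ((m : ℚ) + 1 + i + 1) * this - (2 * i + 4) * (4 ^ (i + (m + 1)) * 2) * e2
  have hcat : ((i : ℚ) + 1) * catalan i = (2 * i).choose i := by
    exact_mod_cast succ_mul_catalan_eq_centralBinom i
  have hcat' : ((i : ℚ) + 2) * (i + 1) * catalan (i + 1) = 2 * (2 * i + 1) * (2 * i).choose i := by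
    have a1 := succ_mul_catalan_eq_centralBinom (i + 1)
    have a2 := Nat.succ_mul_centralBinom_succ i
    rw [← a1] at a2
    rw [Nat.centralBinom] at a2
    have a3 : ((i : ℚ) + 1) * ((i + 1 + 1) * catalan (i + 1)) =
        2 * (2 * i + 1) * (2 * i).choose i := by exact_mod_cast a2
    linear_combination a3
  rw [pow_add 4] at h1 h2
  rw [pow_succ 4] at hcoeff
  have p0 : ((m : ℚ) + i + 1) ≠ 0 := by positivity
  have p1 : (2 * (m : ℚ) + 2 * i + 1) ≠ 0 := by positivity
  have p2 : (n : ℚ) + 1 ≠ 0 := by positivity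
  have p3 : (i : ℚ) + 1 ≠ 0 := by positivity
  have p4 : (4 : ℚ) ^ i ≠ 0 := by positivity
  rw [div_mul_eq_mul_div, div_mul_eq_mul_div, eq_div_iff (mul_ne_zero p0 p1)]
  refine mul_left_cancel₀ (mul_ne_zero (mul_ne_zero p2 p3) p4) ?_
  generalize ((2 * i).choose i : ℚ) = B at *
  generalize (n.choose m : ℚ) = N at *
  generalize ((n + 1).choose m : ℚ) = N' at *
  generalize (catalan i : ℚ) = c at *
  generalize (catalan (i + 1) : ℚ) = c' at *
  generalize PowerSeries.coeff (n + 1) (W ^ (2 * i + 1)) = A at *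
  generalize PowerSeries.coeff (n + 1) (W ^ (2 * i + 4)) = A' at *
  generalize (q i 0 n : ℚ) = y at *
  generalize (4 : ℚ) ^ i = u at *
  generalize (4 : ℚ) ^ m = v at *
  have key : 8 * u * (n + 1) * (i + 1) * (m + i + 1) * y =
      8 * u * v * (2 * i + 1) * (i + 1) * B * N' := by
    linear_combination ((n : ℚ) + 1) * (i + 1) * (m + i + 1) * hcoeff
      + 4 * (i + 1) * c * (m + i + 1) * h1 - (i + 1) * c' * h2
      + 8 * (m + i + 1) * (2 * i + 1) * N' * u * v * hcat - 4 * m * N' * u * v * hcat'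
  linear_combination (2 * (m : ℚ) + 2 * i + 1) / 8 * key - u * v * (2 * i + 1) * (i + 1) * B * e1

/-! ### Walks ending on the diagonal -/

/-- The generating function of walks ending on or below the diagonal: `x` marks the second
coordinate of the endpoint `(i + k, i)`, and `y` marks `k`. -/
def belowDiagonal : PowerSeries (Polynomial (Polynomial ℚ)) :=
  PowerSeries.mk fun n => ∑ k ∈ Finset.range (n + 1), ∑ i ∈ Finset.range (n + 1),
    Polynomial.monomial k (Polynomial.monomial i (q (i + k) i n : ℚ))

theorem coeff₃_belowDiagonal (i k n : ℕ) : coeff₃ i k n belowDiagonal = q (i + k) i n := by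
  simp only [coeff₃, belowDiagonal, PowerSeries.coeff_mk, Polynomial.finsetSum_coeff,
    Polynomial.coeff_monomial]
  rw [Finset.sum_eq_single k, Finset.sum_eq_single i]
  · simp
  · intro b _ hb
    simp [Polynomial.coeff_monomial, hb]
  · intro h
    rw [q_eq_zero (Or.inr (by simpa using h))]
    simp
  · intro b _ hb
    simp [hb]
  · intro h
    refine Finset.sum_eq_zero fun b _ => ?_
    rw [q_eq_zero (Or.inl (by simp at h; omega))]
    simp

/-- A last step NE keeps the distance to the diagonal, W lowers it and S raises it; `Qd` corrects
for W steps leaving the half-plane and `Qx0` for S steps leaving the quadrant. A walk may also reach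
the diagonal from above; by symmetry such arrivals are half of those by W or S. Expressing them
through `Qd` accounts for the factor `2`. -/
theorem belowDiagonal_functional_equation :
    2 * belowDiagonal * (inner x * outer x * (1 - PowerSeries.X * inner x) -
        PowerSeries.X * inner x - PowerSeries.X * outer x ^ 2) =
      inner x * outer x * (1 - PowerSeries.X * inner x) * inner Qd -
        2 * PowerSeries.X * inner x * inner Qd + inner x * outer x -
        2 * PowerSeries.X * outer x ^ 2 * outer Qx0 := by
  have key : outer x * (inner x * (belowDiagonal + belowDiagonal)) +
      PowerSeries.X * (outer x * (inner x * (inner x * inner Qd))) +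
      PowerSeries.X * (inner x * (inner Qd + inner Qd)) +
      PowerSeries.X * (outer x * (outer x * (outer Qx0 + outer Qx0))) =
      PowerSeries.X * (outer x * (inner x * (inner x * (belowDiagonal + belowDiagonal)))) +
      PowerSeries.X * (inner x * (belowDiagonal + belowDiagonal)) +
      PowerSeries.X * (outer x * (outer x * (belowDiagonal + belowDiagonal))) +
      outer x * (inner x * inner Qd) + outer x * (inner x * 1) := by
    refine ext₃ fun i j n => ?_
    simp only [coeff₃_add]
    rcases i with _ | i
    · rcases n with _ | n
      · rcases j with _ | _ | j <;>
        simp only [coeff₃_zero_x_mul, coeff₃_zero_y_mul, coeff₃_succ_y_mul, coeff₃_zero_t_mul,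
          add_zero]
      · rcases j with _ | _ | j <;>
        simp only [coeff₃_zero_x_mul, coeff₃_zero_y_mul, coeff₃_succ_y_mul, coeff₃_succ_t_mul,
          coeff₃_add, coeff₃_outer, coeff₃_belowDiagonal, coeff_Qx0, if_true, zero_add, add_zero]
    rcases n with _ | n
    · rcases j with _ | _ | j
      · simp only [coeff₃_zero_y_mul, coeff₃_zero_t_mul, add_zero]
      · simp only [coeff₃_succ_x_mul, coeff₃_succ_y_mul, coeff₃_zero_t_mul,
          coeff₃_add, coeff₃_inner, coeff₃_belowDiagonal, coeff_Qd, coeff₃_one, q_zero]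
        simp
      · simp only [coeff₃_succ_x_mul, coeff₃_succ_y_mul, coeff₃_zero_t_mul,
          coeff₃_add, coeff₃_inner, coeff₃_belowDiagonal, coeff_Qd, coeff₃_one, q_zero]
        simp
    rcases j with _ | _ | j
    · simp only [coeff₃_succ_x_mul, coeff₃_zero_y_mul, coeff₃_succ_t_mul,
        coeff₃_add, coeff₃_inner, coeff₃_belowDiagonal, coeff_Qd]
      simp
    -- The endpoint lies on the diagonal: arrivals from above are turned into arrivals from below by
    -- `q_comm`.
    · rcases i with _ | i
      · simp only [coeff₃_succ_x_mul, coeff₃_zero_x_mul, coeff₃_zero_y_mul, coeff₃_succ_y_mul,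
          coeff₃_succ_t_mul, coeff₃_add, coeff₃_inner, coeff₃_belowDiagonal, coeff_Qd, coeff₃_one]
        simp [q_succ_of_eq_zero, q_comm 0 1]
      · simp only [coeff₃_succ_x_mul, coeff₃_zero_y_mul, coeff₃_succ_y_mul,
          coeff₃_succ_t_mul, coeff₃_add, coeff₃_inner, coeff₃_belowDiagonal, coeff_Qd, coeff₃_one]
        simp [q_succ_succ_succ, q_comm (i + 1) (i + 2)]
        ring
    · rcases i with _ | i
      · simp only [coeff₃_succ_x_mul, coeff₃_zero_x_mul, coeff₃_succ_y_mul, coeff₃_outer,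
          coeff₃_succ_t_mul, coeff₃_add, coeff₃_inner, coeff₃_belowDiagonal, coeff₃_one]
        simp [q_succ_of_eq_zero]
        ring_nf
      · simp only [coeff₃_succ_x_mul, coeff₃_succ_y_mul, coeff₃_outer,
          coeff₃_succ_t_mul, coeff₃_add, coeff₃_inner, coeff₃_belowDiagonal, coeff₃_one]
        rw [show i + 1 + (j + 1) = (i + j + 1) + 1 by ring, q_succ_succ_succ]
        simp
        ring_nf
  linear_combination key

/-- A multiple of the diagonal kernel that is a monomial in the outer variable vanishes. -/
theorem eq_zero_of_diagonal_kernel_mul {G : PowerSeries (Polynomial (Polynomial ℚ))}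
    {β : PowerSeries (Polynomial ℚ)}
    (h : (inner x * outer x * (1 - PowerSeries.X * inner x) - PowerSeries.X * inner x -
      PowerSeries.X * outer x ^ 2) * G = inner β * outer x ^ 2) : β = 0 := by
  have h' : outer x * (inner x * G) = PowerSeries.X * (outer x * (inner x * (inner x * G))) +
      PowerSeries.X * (inner x * G) + PowerSeries.X * (outer x * (outer x * G)) +
      outer x * (outer x * inner β) := by
    linear_combination h
  have hcoeff := fun i j n => congrArg (coeff₃ i j n) h'
  simp only [coeff₃_add] at hcoeff
  -- The lowest powers of the outer variable show that its square divides `G`. Beyond that, the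
  -- `t^n` part of `G` is determined by the `t^(n-1)` part with no contribution of `β`, so `G`
  -- vanishes by induction.
  have g0 : ∀ i n, coeff₃ i 0 n G = 0 := fun i n => by
    have := hcoeff (i + 1) 0 (n + 1)
    simp only [coeff₃_succ_x_mul, coeff₃_zero_y_mul, coeff₃_succ_t_mul] at this
    linarith
  have g1 : ∀ i n, coeff₃ i 1 n G = 0 := fun i n => by
    have := hcoeff (i + 1) 1 (n + 1)
    rw [← zero_add 1] at this
    rcases i with _ | i <;>
    simp only [coeff₃_succ_x_mul, coeff₃_zero_x_mul, coeff₃_zero_y_mul, coeff₃_succ_y_mul,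
      coeff₃_succ_t_mul, g0] at this <;>
    linarith
  have hG : ∀ n i j, coeff₃ i j n G = 0 := by
    intro n
    induction n with
    | zero =>
      rintro i (_ | _ | j)
      · exact g0 _ _
      · exact g1 _ _
      · have := hcoeff (i + 1) (j + 3) 0
        simp only [coeff₃_succ_x_mul, coeff₃_succ_y_mul, coeff₃_zero_t_mul, coeff₃_inner] at this
        simpa using this
    | succ n ih =>
      rintro i (_ | _ | j)
      · exact g0 _ _
      · exact g1 _ _
      · have := hcoeff (i + 1) (j + 3) (n + 1)
        rcases i with _ | i <;>
        simp only [coeff₃_succ_x_mul, coeff₃_zero_x_mul, coeff₃_succ_y_mul, coeff₃_succ_t_mul,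
          coeff₃_inner, ih] at this <;>
        simpa using this
  have hG0 : G = 0 := ext₃ fun i j n => by
    rw [hG]
    simp [coeff₃]
  ext n i
  have := hcoeff i 2 n
  rw [hG0] at this
  simp only [mul_zero, coeff₃_succ_y_mul, coeff₃_inner] at this
  simpa [coeff₃] using this.symm

/-- The quadratic equation with one catalytic variable satisfied by `Q(x,0)`. -/
theorem quadratic_of_catalan {R : Type*} [CommRing R] {x t W c P P₀ : R}
    (hW : W = t * (2 + W ^ 3)) (hc : 4 * c = 4 + x * W ^ 2 * c ^ 2)
    (hP : 8 * P = (2 + W ^ 3) * (4 * c - W ^ 3 * c ^ 2)) (hP₀ : 8 * P₀ = (2 + W ^ 3) * (4 - W ^ 3)) :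
    64 * (x * P) = 64 * (x + 2 * t * (P - P₀) + t ^ 2 * x ^ 2 * P ^ 2) := by
  linear_combination (exp := 1) (8 * x - 16 * t - x ^ 2 * t ^ 2 *
      (8 * P + (2 + W ^ 3) * (4 * c - W ^ 3 * c ^ 2))) * hP + 16 * t * hP₀
    + (16 * (4 * c - W ^ 3 * c ^ 2) - 16 * (4 - W ^ 3)
      + x ^ 2 * (4 * c - W ^ 3 * c ^ 2) ^ 2 * (W + t * (2 + W ^ 3))) * hW
    + (8 * (2 + W ^ 3) * W - W ^ 3 * (x * (4 * c - W ^ 3 * c ^ 2) + (4 * x * c - 4 * W * (c - 1)))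
      + 16 * x - 32 * W) * hc

/-- `P₀` is the value at `c = 1`, that is, at `x = 0`. -/
theorem Qx0_quadratic {W : PowerSeries ℚ} (hW : W = PowerSeries.X * (2 + W ^ 3)) :
    ∃ P₀ : PowerSeries ℚ, 8 * P₀ = (2 + W ^ 3) * (4 - W ^ 3) ∧
      x * Qx0 = x + 2 * PowerSeries.X * (Qx0 - lift P₀) + PowerSeries.X ^ 2 * x ^ 2 * Qx0 ^ 2 := by
  obtain ⟨c, hc⟩ := exists_catalan_series hW
  have h8 : 8 * (algebraMap ℚ (PowerSeries ℚ) (1 / 8)) = 1 := by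
    rw [show (8 : PowerSeries ℚ) = algebraMap ℚ _ 8 by simp [map_ofNat], ← map_mul]
    norm_num
  have h64 : algebraMap ℚ (PowerSeries (Polynomial ℚ)) (1 / 64) * 64 = 1 := by
    rw [show (64 : PowerSeries (Polynomial ℚ)) = algebraMap ℚ _ 64 by simp [map_ofNat], ← map_mul]
    norm_num
  refine ⟨algebraMap ℚ (PowerSeries ℚ) (1 / 8) * ((2 + W ^ 3) * (4 - W ^ 3)), ?_, ?_⟩
  · rw [← mul_assoc, h8, one_mul]
  generalize hp : algebraMap ℚ (PowerSeries ℚ) (1 / 8) * ((2 + W ^ 3) * (4 - W ^ 3)) = P₀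
  have hP₀ : 8 * P₀ = (2 + W ^ 3) * (4 - W ^ 3) := by rw [← hp, ← mul_assoc, h8, one_mul]
  have hP₀' : 8 * lift P₀ = (2 + lift W ^ 3) * (4 - lift W ^ 3) := by
    simpa [lift, map_ofNat] using congrArg lift hP₀
  have := congrArg (algebraMap ℚ (PowerSeries (Polynomial ℚ)) (1 / 64) * ·)
    (quadratic_of_catalan (lift_eq hW) hc (Qx0_eq hW hc) hP₀')
  simpa only [← mul_assoc, h64, one_mul] using this

/-- Modulo `k`, `hF` says `2ts²P ≡ B`, so `hP` becomes a quadratic congruence for `B` without `P`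
(`h1`). Also `B ≡ B₀` modulo `k`, and reducing the quadratic in `B₀` once more (`h2`) leaves `s²`
times an expression free of `s`. Working with divisibility avoids substituting the roots of the
kernel. -/
theorem diagonal_elimination {R : Type*} [CommRing R] {z s t f F P P₀ k : R}
    (hk : k = z * s * (1 - t * z) - t * z - t * s ^ 2)
    (hF : 2 * F * k = z * s * (1 - t * z) * f - 2 * t * z * f + z * s - 2 * t * s ^ 2 * P)
    (hP : s * P = s + 2 * t * (P - P₀) + t ^ 2 * s ^ 2 * P ^ 2) :
    k ∣ ((z * (1 - t * z) ^ 2 - 4 * t ^ 2) * (1 - t * z * f) ^ 2 -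
      (z - 4 * t ^ 2 - 4 * t * z ^ 2 + 4 * t ^ 2 * z ^ 3 + 8 * t ^ 3 * z * P₀)) * s ^ 2 := by
  obtain ⟨B, hB⟩ : ∃ B, B = z * s * (1 - t * z) * f - 2 * t * z * f + z * s := ⟨_, rfl⟩
  obtain ⟨B₀, hB₀⟩ : ∃ B₀, B₀ = f * t * (s ^ 2 - z) + z * s := ⟨_, rfl⟩
  have hBB : B = B₀ + f * k := by
    rw [hB, hB₀, hk]
    ring
  have hF' : 2 * F * k = B - 2 * t * s ^ 2 * P := by rw [hF, hB]
  have h1 : 2 * F * k * (t * B - 2 * s + 4 * t + 2 * t ^ 2 * s ^ 2 * P) =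
      t * B ^ 2 - 2 * B * (s - 2 * t) + 4 * t * s ^ 3 - 8 * t ^ 2 * P₀ * s ^ 2 := by
    rw [hF']
    linear_combination 4 * t * s ^ 2 * hP
  have h2 : z * t * (t * B₀ ^ 2 - 2 * B₀ * (s - 2 * t) + 4 * t * s ^ 3 - 8 * t ^ 2 * P₀ * s ^ 2) =
      ((z * (1 - t * z) ^ 2 - 4 * t ^ 2) * (1 - t * z * f) ^ 2 -
      (z - 4 * t ^ 2 - 4 * t * z ^ 2 + 4 * t ^ 2 * z ^ 3 + 8 * t ^ 3 * z * P₀)) * s ^ 2 +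
      k * (f ^ 2 * t ^ 2 * z * (k - 2 * z * s * (1 - t * z)) -
        f * (2 * t * (k - 2 * z * s * (1 - t * z)) + 2 * t ^ 2 * (s ^ 2 - z)) - 4 * t * z * s) := by
    rw [hB₀, hk]
    ring
  refine ⟨2 * z * t * F * (t * B - 2 * s + 4 * t + 2 * t ^ 2 * s ^ 2 * P) -
    z * t * (f * t * (B + B₀) - 2 * f * (s - 2 * t)) -
    (f ^ 2 * t ^ 2 * z * (k - 2 * z * s * (1 - t * z)) -
        f * (2 * t * (k - 2 * z * s * (1 - t * z)) + 2 * t ^ 2 * (s ^ 2 - z)) - 4 * t * z * s), ?_⟩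
  linear_combination -z * t * h1 - h2 + z * t * (-t * (B + B₀) + 2 * (s - 2 * t)) * hBB

theorem Qd_equation {W : PowerSeries ℚ} (hW : W = PowerSeries.X * (2 + W ^ 3)) :
    ∃ P₀ : PowerSeries ℚ, 8 * P₀ = (2 + W ^ 3) * (4 - W ^ 3) ∧
      (x * (1 - PowerSeries.X * x) ^ 2 - 4 * PowerSeries.X ^ 2) *
        (1 - PowerSeries.X * x * Qd) ^ 2 =
      x - 4 * PowerSeries.X ^ 2 - 4 * PowerSeries.X * x ^ 2 + 4 * PowerSeries.X ^ 2 * x ^ 3 +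
        8 * PowerSeries.X ^ 3 * x * lift P₀ := by
  obtain ⟨P₀, hP₀, hP⟩ := Qx0_quadratic hW
  refine ⟨P₀, hP₀, ?_⟩
  have hP' : outer x * outer Qx0 = outer x + 2 * PowerSeries.X * (outer Qx0 - inner (lift P₀)) +
      PowerSeries.X ^ 2 * outer x ^ 2 * outer Qx0 ^ 2 := by
    simpa [map_ofNat, outer_lift, outer_X] using congrArg outer hP
  obtain ⟨G, hG⟩ := diagonal_elimination rfl belowDiagonal_functional_equation hP'
  rw [← sub_eq_zero]
  apply eq_zero_of_diagonal_kernel_mul (G := G)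
  rw [← hG]
  simp [map_ofNat, inner_X]

theorem Qd_mul_sqrt {W : PowerSeries ℚ} (hW : W = PowerSeries.X * (2 + W ^ 3)) :
    (1 - PowerSeries.X * x * Qd) * sqrt (1 - x * lift W * (1 + (1 / 4 : ℚ) • lift W ^ 3)
      + (1 / 4 : ℚ) • (x ^ 2 * lift W ^ 2)) = 1 - x * lift W := by
  obtain ⟨P₀, hP₀, h⟩ := Qd_equation hW
  have hW' := lift_eq hW
  have hP₀' : 8 * lift P₀ = (2 + lift W ^ 3) * (4 - lift W ^ 3) := by
    simpa [lift, map_ofNat] using congrArg lift hP₀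
  have hconst : PowerSeries.constantCoeff (lift W) = 0 := by
    rw [hW']
    simp
  have hF : PowerSeries.constantCoeff (1 - x * lift W * (1 + (1 / 4 : ℚ) • lift W ^ 3)
      + (1 / 4 : ℚ) • (x ^ 2 * lift W ^ 2)) = 1 := by
    simp [hconst, Algebra.smul_def]
  have hr := sqrt_sq hF
  have hr1 := constantCoeff_sqrt hF
  have h4 : 4 * algebraMap ℚ (PowerSeries (Polynomial ℚ)) (1 / 4) = 1 := by
    rw [show (4 : PowerSeries (Polynomial ℚ)) = algebraMap ℚ _ 4 by simp [map_ofNat], ← map_mul]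
    norm_num
  rw [Algebra.smul_def, Algebra.smul_def] at hr hr1 ⊢
  generalize sqrt (1 - x * lift W * (1 + algebraMap ℚ _ (1 / 4) * lift W ^ 3)
      + algebraMap ℚ _ (1 / 4) * (x ^ 2 * lift W ^ 2)) = r at *
  generalize algebraMap ℚ (PowerSeries (Polynomial ℚ)) (1 / 4) = a at *
  have hr4 : 4 * r ^ 2 = 4 - x * lift W * (4 + lift W ^ 3) + x ^ 2 * lift W ^ 2 := by
    linear_combination 4 * hr + (x ^ 2 * lift W ^ 2 - x * lift W * lift W ^ 3) * h4
  have hsq : ((1 - PowerSeries.X * x * Qd) * r) ^ 2 = (1 - x * lift W) ^ 2 := by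
    have hu : PowerSeries.X * (2 + lift W ^ 3) = lift W := hW'.symm
    have hP₁ : 8 * PowerSeries.X * lift P₀ = lift W * (4 - lift W ^ 3) := by
      linear_combination PowerSeries.X * hP₀' + (4 - lift W ^ 3) * hu
    have hV : 2 + lift W ^ 3 ≠ 0 := by
      intro h0
      rw [h0, mul_zero] at hu
      exact ne_zero_of_eq hW (lift_injective (hu.symm.trans (map_zero _).symm))
    have hD : x * (1 - PowerSeries.X * x) ^ 2 - 4 * PowerSeries.X ^ 2 ≠ 0 := by
      intro h0
      have := congrArg PowerSeries.constantCoeff h0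
      simp [x] at this
    have h4' : (4 : PowerSeries (Polynomial ℚ)) ≠ 0 := left_ne_zero_of_mul_eq_one h4
    generalize (PowerSeries.X : PowerSeries (Polynomial ℚ)) = t at *
    have e1 : (2 + lift W ^ 3) ^ 2 * (x * (1 - t * x) ^ 2 - 4 * t ^ 2) =
        x * (2 + lift W ^ 3 - lift W * x) ^ 2 - 4 * lift W ^ 2 := by
      linear_combination (x * (-2 * (2 + lift W ^ 3) * x +
        x ^ 2 * (t * (2 + lift W ^ 3) + lift W)) - 4 * (t * (2 + lift W ^ 3) + lift W)) * hu
    have e2 : (2 + lift W ^ 3) ^ 2 * (x - 4 * t ^ 2 - 4 * t * x ^ 2 + 4 * t ^ 2 * x ^ 3 +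
        8 * t ^ 3 * x * lift P₀) = x * (2 + lift W ^ 3) ^ 2 - 4 * lift W ^ 2 -
        4 * lift W * (2 + lift W ^ 3) * x ^ 2 + 4 * lift W ^ 2 * x ^ 3 +
        lift W ^ 2 * x * (lift W * (4 - lift W ^ 3)) := by
      linear_combination ((-4 + 4 * x ^ 3 + lift W * (4 - lift W ^ 3) * x) *
        (t * (2 + lift W ^ 3) + lift W) - 4 * (2 + lift W ^ 3) * x ^ 2) * hu +
        t ^ 2 * (2 + lift W ^ 3) ^ 2 * x * hP₁
    refine mul_left_cancel₀ (mul_ne_zero (mul_ne_zero h4' (pow_ne_zero 2 hV)) hD) ?_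
    -- The right-hand sides of `e1` and `e2` are `4(x - W²)` times the radicand `r²` and `(1 - xW)²`
    -- respectively; the common factor cancels between the two sides.
    linear_combination 4 * (2 + lift W ^ 3) ^ 2 * r ^ 2 * h + 4 * r ^ 2 * e2 -
      4 * (1 - x * lift W) ^ 2 * e1 + (x * (2 + lift W ^ 3) ^ 2 - 4 * lift W ^ 2 -
        4 * lift W * (2 + lift W ^ 3) * x ^ 2 + 4 * lift W ^ 2 * x ^ 3 +
        lift W ^ 2 * x * (lift W * (4 - lift W ^ 3))) * hr4
  rcases sq_eq_sq_iff_eq_or_eq_neg.1 hsq with h1 | h1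
  · exact h1
  · have h2 := congrArg PowerSeries.constantCoeff h1
    simp [hconst, hr1] at h2
    have h3 := congrArg (Polynomial.eval 0) h2
    norm_num at h3

theorem incl_Qd {W : PowerSeries ℚ} (hW : W = PowerSeries.X * (2 + W ^ 3)) :
    incl Qd = (incl (lift W) - 1 / incl x) / (incl PowerSeries.X *
      incl (sqrt (1 - x * lift W * (1 + (1 / 4 : ℚ) • lift W ^ 3)
        + (1 / 4 : ℚ) • (x ^ 2 * lift W ^ 2)))) + 1 / incl x / incl PowerSeries.X := by
  have h := congrArg incl (Qd_mul_sqrt hW)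
  have hne : ∀ {F}, F ≠ 0 → incl F ≠ 0 := fun h => by rwa [Ne, map_eq_zero_iff _ incl_injective]
  have hx := hne x_ne_zero
  have ht := hne (F := PowerSeries.X) PowerSeries.X_ne_zero
  have hconst : PowerSeries.constantCoeff (lift W) = 0 := by
    rw [lift_eq hW]
    simp
  rw [map_mul, map_sub, map_sub, map_mul, map_mul, map_mul, map_one] at h
  have hr : incl (sqrt (1 - x * lift W * (1 + (1 / 4 : ℚ) • lift W ^ 3)
        + (1 / 4 : ℚ) • (x ^ 2 * lift W ^ 2))) ≠ 0 := by
    refine hne fun h0 => ?_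
    have h1 := constantCoeff_sqrt (F := 1 - x * lift W * (1 + (1 / 4 : ℚ) • lift W ^ 3)
        + (1 / 4 : ℚ) • (x ^ 2 * lift W ^ 2)) (by simp [hconst, Algebra.smul_def])
    rw [h0, map_zero] at h1
    exact zero_ne_one h1
  generalize incl (sqrt _) = r at *
  field_simp
  linear_combination -h

end QuarterPlane

end

theorem mainTheorem7 :
    (∃! W : PowerSeries ℚ, W = PowerSeries.X * (2 + W ^ 3)) ∧
    ∀ W : PowerSeries ℚ, W = PowerSeries.X * (2 + W ^ 3) →
      -- the series `Q(x,0;t)`, an identity in `ℚ(x)((t))`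
      (let t := QuarterPlane.incl PowerSeries.X
       let x := QuarterPlane.incl QuarterPlane.x
       let w := QuarterPlane.incl (QuarterPlane.lift W)
       let r := QuarterPlane.incl
        (QuarterPlane.sqrt (1 - QuarterPlane.x * QuarterPlane.lift W ^ 2))
       QuarterPlane.incl QuarterPlane.Qx0
        = 1 / (t * x) * (1 / (2 * t) - 1 / x - (1 / w - 1 / x) * r)) ∧
      -- the coefficient of `x^i` in `Q(x,0;t)`, an identity in `ℚ((t))`
      (∀ i : ℕ,
        let t := QuarterPlane.incl₀ PowerSeries.X
        let w := QuarterPlane.incl₀ W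
        QuarterPlane.incl₀ (QuarterPlane.coeffX i QuarterPlane.Qx0)
          = w ^ (2 * i + 1) / (2 * 4 ^ i * t) *
            ((catalan i : LaurentSeries ℚ) - (catalan (i + 1) : LaurentSeries ℚ) * w ^ 3 / 4)) ∧
      -- the number of walks of length `3m+2i` ending at `(i,0)`
      (∀ i m : ℕ,
        (QuarterPlane.q i 0 (3 * m + 2 * i) : ℚ)
          = 4 ^ m * (2 * (i : ℚ) + 1) / (((m : ℚ) + i + 1) * (2 * (m : ℚ) + 2 * i + 1)) *
            (Nat.choose (2 * i) i : ℚ) * (Nat.choose (3 * m + 2 * i) m : ℚ)) ∧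
      -- the series `Q_d(x;t)`, an identity in `ℚ(x)((t))`
      (let t := QuarterPlane.incl PowerSeries.X
       let x := QuarterPlane.incl QuarterPlane.x
       let w := QuarterPlane.incl (QuarterPlane.lift W)
       let r := QuarterPlane.incl
        (QuarterPlane.sqrt
          (1 - QuarterPlane.x * QuarterPlane.lift W * (1 + (1 / 4 : ℚ) • QuarterPlane.lift W ^ 3)
            + (1 / 4 : ℚ) • (QuarterPlane.x ^ 2 * QuarterPlane.lift W ^ 2)))
       QuarterPlane.incl QuarterPlane.Qd = (w - 1 / x) / (t * r) + 1 / x / t) := by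
  refine ⟨QuarterPlane.existsUnique_W, fun W hW => ⟨?_, ?_, ?_, ?_⟩⟩
  · exact QuarterPlane.incl_Qx0 hW
  · exact QuarterPlane.incl₀_coeffX_Qx0 hW
  · exact QuarterPlane.q_eq
  · exact QuarterPlane.incl_Qd hW
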